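/- Let $X=(VX,EX)$ be a connected, countable undirected graph (multiple edges and loops allowed) whose vertex degrees are bounded, $\sup_{x\in VX}\deg(x)<\infty$. Let $A_X$ be its adjacency operator, i.e. the bounded operator on $\ell^2(VX)$ with $\langle\delta_x,A_X\delta_y\rangle=|E_{x,y}|$, where $E_{x,y}$ is the set of edges joining $x$ and $y$, and put $H:=\|A_X\|\mathbb 1-A_X$. Assume that $A_X$ is transient: for every $x\in VX$ the limit $\lim_{\lambda\searrow\|A_X\|}\langle\delta_x,(\lambda\mathbb 1-A_X)^{-1}\delta_x\rangle$ exists and is finite. Let $\mathfrak h_2\subset\ell^2(VX)$ be the complex linear span of the vectors $$\int_{\mathbb R}p(t)\,e^{-(t-a)^2/b}\,e^{itH}\delta_x\,dt,\qquad p\in\mathbb C[t],\ a\in\mathbb R,\ b>0,\ x\in VX .$$ Then: 1. $e^{itH}\mathfrak h_2=\mathfrak h_2$ for all $t\in\mathbb R$. 2. For every $\beta>0$, $e^{\beta H}\mathfrak h_2\subset\mathcal D\big((e^{\beta H}-\mathbb 1)^{-1/2}\big)$, where $(e^{\beta H}-\mathbb 1)^{-1/2}$ is the inverse of the positive square root of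 $e^{\beta H}-\mathbb 1$, so that its domain is the range of $(e^{\beta H}-\mathbb 1)^{1/2}$. 3. Let $v$ be any Perron–Frobenius weight for $A_X$, i.e. a family $(v(x))_{x\in VX}$ of strictly positive numbers, not necessarily square summable, with $\sum_{y\in VX}\langle\delta_x,A_X\delta_y\rangle v(y)=\|A_X\|\,v(x)$ for all $x\in VX$. Then for every $\beta>0$ and every $u\in\mathfrak h_2$, $$\sum_{x\in VX}|(e^{\beta H}u)(x)|\,v(x)<\infty,\qquad \sum_{x\in VX}|u(x)|\,v(x)<\infty,\qquad \langle e^{\beta H}u,v\rangle=\langle u,v\rangle,$$ where $\langle w,v\rangle:=\sum_{x\in VX}\overline{w(x)}\,v(x)$. -/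

import Mathlib

open Filter Topology
open scoped Graph InnerProductSpace

noncomputable section

namespace GraphBEC

/-! ### Graphs

`Graph α β` is Mathlib's type of undirected multigraphs (loops and multiple edges are allowed),
with vertex set `V(G)` and edge set `E(G)`. -/

section GraphNotions

variable {α β : Type*}

/-- Any two vertices are joined by a finite path, and there is at least one vertex. -/
def IsConnected (G : Graph α β) : Prop :=
  V(G).Nonempty ∧ ∀ x ∈ V(G), ∀ y ∈ V(G), Relation.ReflTransGen G.Adj x y

/-- The degree of a vertex: the number of incident edges, where loops are counted twice. -/
def degree (G : Graph α β) (x : V(G)) : ℕ∞ :=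
  (G.incidenceSet (x : α)).encard + (G.loopSet (x : α)).encard

/-- The supremum of the degrees is finite. -/
def HasBoundedDegree (G : Graph α β) : Prop :=
  ⨆ x : V(G), degree G x < ⊤

/-- The number `|E_{x,y}|` of edges joining `x` and `y`. -/
def edgeCount (G : Graph α β) (x y : V(G)) : ℕ :=
  {e | G.IsLink e (x : α) (y : α)}.ncard

end GraphNotions

/-! ### The Hilbert space `ℓ²` and its canonical basis -/

/-- The Hilbert space of square summable complex families indexed by `V`. -/
abbrev L2 (V : Type*) : Type _ := lp (fun _ : V => ℂ) 2

open Classical in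
/-- The unit vector `δ_x`. -/
def delta {V : Type*} (x : V) : L2 V := lp.single 2 x (1 : ℂ)

theorem delta_apply_self {V : Type*} (x : V) : delta x x = 1 := by
  simp [delta]

theorem delta_apply_ne {V : Type*} {x y : V} (h : y ≠ x) : delta x y = 0 := by
  simp [delta, h]

open Classical in
theorem inner_delta_left {V : Type*} (x : V) (f : L2 V) : ⟪delta x, f⟫_ℂ = f x := by
  rw [delta, lp.inner_single_left]
  simp

/-! ### Operators given by symmetric matrices with bounded row sums -/

section Matrix

variable {V : Type*} {m : V → V → ℕ} {d : ℕ}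

theorem support_finite (hd : ∀ x, ∀ s : Finset V, ∑ y ∈ s, m x y ≤ d) (x : V) :
    {y | m x y ≠ 0}.Finite := by
  by_contra h
  obtain ⟨s, hs, hc⟩ := Set.Infinite.exists_subset_card_eq h (d + 1)
  have h1 := hd x s
  have h2 : ∑ y ∈ s, 1 ≤ ∑ y ∈ s, m x y :=
    Finset.sum_le_sum fun y hy => Nat.one_le_iff_ne_zero.2 (hs hy)
  simp only [Finset.sum_const, smul_eq_mul, mul_one] at h2
  omega

theorem tsum_eq_sum_support (hd : ∀ x, ∀ s : Finset V, ∑ y ∈ s, m x y ≤ d) (f : V → ℂ) (x : V) :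
    ∑' y, (m x y : ℂ) * f y = ∑ y ∈ (support_finite hd x).toFinset, (m x y : ℂ) * f y := by
  apply tsum_eq_sum
  intro y hy
  have : m x y = 0 := by simpa using hy
  simp [this]

theorem summable_row (hd : ∀ x, ∀ s : Finset V, ∑ y ∈ s, m x y ≤ d) (f : V → ℂ) (x : V) :
    Summable fun y => (m x y : ℂ) * f y := by
  apply summable_of_ne_finset_zero (s := (support_finite hd x).toFinset)
  intro y hy
  have : m x y = 0 := by simpa using hy
  simp [this]

theorem row_sq_le (hd : ∀ x, ∀ s : Finset V, ∑ y ∈ s, m x y ≤ d) (f : V → ℂ) (x : V)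
    (U : Finset V) (hU : (support_finite hd x).toFinset ⊆ U) :
    ‖∑' y, (m x y : ℂ) * f y‖ ^ 2 ≤ d * ∑ y ∈ U, (m x y : ℝ) * ‖f y‖ ^ 2 := by
  rw [tsum_eq_sum_support hd]
  set R := (support_finite hd x).toFinset
  have h1 : ‖∑ y ∈ R, (m x y : ℂ) * f y‖ ≤ ∑ y ∈ R, (m x y : ℝ) * ‖f y‖ := by
    refine (norm_sum_le _ _).trans (le_of_eq ?_)
    simp
  have h2 : (∑ y ∈ R, (m x y : ℝ) * ‖f y‖) ^ 2
      ≤ (∑ y ∈ R, (m x y : ℝ)) * ∑ y ∈ R, (m x y : ℝ) * ‖f y‖ ^ 2 := by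
    apply Finset.sum_sq_le_sum_mul_sum_of_sq_le_mul
    · intro i _; positivity
    · intro i _; positivity
    · intro i _; exact le_of_eq (by ring)
  have h3 : (∑ y ∈ R, (m x y : ℝ)) ≤ d := by exact_mod_cast hd x R
  have h4 : ∑ y ∈ R, (m x y : ℝ) * ‖f y‖ ^ 2 ≤ ∑ y ∈ U, (m x y : ℝ) * ‖f y‖ ^ 2 :=
    Finset.sum_le_sum_of_subset_of_nonneg hU fun i _ _ => by positivity
  have h5 : 0 ≤ ∑ y ∈ R, (m x y : ℝ) * ‖f y‖ ^ 2 :=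
    Finset.sum_nonneg fun i _ => by positivity
  calc ‖∑ y ∈ R, (m x y : ℂ) * f y‖ ^ 2 ≤ (∑ y ∈ R, (m x y : ℝ) * ‖f y‖) ^ 2 := by gcongr
    _ ≤ _ := h2
    _ ≤ d * ∑ y ∈ U, (m x y : ℝ) * ‖f y‖ ^ 2 := by gcongr

open Classical in
theorem sum_row_sq_le (hs : ∀ x y, m x y = m y x)
    (hd : ∀ x, ∀ s : Finset V, ∑ y ∈ s, m x y ≤ d) (f : L2 V) (t : Finset V) :
    ∑ x ∈ t, ‖∑' y, (m x y : ℂ) * f y‖ ^ 2 ≤ ((d : ℝ) * ‖f‖) ^ 2 := by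
  set U : Finset V := t.biUnion fun x => (support_finite hd x).toFinset with hU
  have hf : ∑ y ∈ U, ‖f y‖ ^ 2 ≤ ‖f‖ ^ 2 := by
    have := lp.sum_rpow_le_norm_rpow (p := 2) (by norm_num) f U
    simpa using this
  calc ∑ x ∈ t, ‖∑' y, (m x y : ℂ) * f y‖ ^ 2
      ≤ ∑ x ∈ t, d * ∑ y ∈ U, (m x y : ℝ) * ‖f y‖ ^ 2 := by
        refine Finset.sum_le_sum fun x hx => row_sq_le hd _ x U ?_
        exact Finset.subset_biUnion_of_mem (fun x => (support_finite hd x).toFinset) hx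
    _ = d * ∑ y ∈ U, (∑ x ∈ t, (m y x : ℝ)) * ‖f y‖ ^ 2 := by
        rw [← Finset.mul_sum, Finset.sum_comm]
        simp only [Finset.sum_mul]
        simp only [hs]
    _ ≤ d * ∑ y ∈ U, (d : ℝ) * ‖f y‖ ^ 2 := by
        gcongr with y hy
        exact_mod_cast hd y t
    _ = d * (d * ∑ y ∈ U, ‖f y‖ ^ 2) := by rw [← Finset.mul_sum]
    _ ≤ d * (d * ‖f‖ ^ 2) := by gcongr
    _ = _ := by ring

theorem memLp_row (hs : ∀ x y, m x y = m y x)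
    (hd : ∀ x, ∀ s : Finset V, ∑ y ∈ s, m x y ≤ d) (f : L2 V) :
    Memℓp (fun x => ∑' y, (m x y : ℂ) * f y) 2 := by
  apply memℓp_gen' (C := ((d : ℝ) * ‖f‖) ^ 2)
  intro t
  simpa using sum_row_sq_le hs hd f t

/-- The bounded operator `(B f)(x) = ∑_y m x y f(y)` on `ℓ²`. -/
def matrixOperator (hs : ∀ x y, m x y = m y x)
    (hd : ∀ x, ∀ s : Finset V, ∑ y ∈ s, m x y ≤ d) : L2 V →L[ℂ] L2 V :=
  LinearMap.mkContinuous
    { toFun := fun f => ⟨fun x => ∑' y, (m x y : ℂ) * f y, memLp_row hs hd f⟩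
      map_add' := by
        intro f g
        ext x
        change ∑' y, (m x y : ℂ) * (f y + g y) = _ + _
        simp only [mul_add]
        exact (summable_row hd _ x).tsum_add (summable_row hd _ x)
      map_smul' := by
        intro c f
        ext x
        change ∑' y, (m x y : ℂ) * (c * f y) = c * ∑' y, (m x y : ℂ) * f y
        rw [← tsum_mul_left]
        congr 1
        ext y
        ring }
    d (by
      intro f
      apply lp.norm_le_of_forall_sum_le (p := 2) (by norm_num) (by positivity)
      intro t
      simpa using sum_row_sq_le hs hd f t)

theorem matrixOperator_apply (hs : ∀ x y, m x y = m y x)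
    (hd : ∀ x, ∀ s : Finset V, ∑ y ∈ s, m x y ≤ d) (f : L2 V) (x : V) :
    matrixOperator hs hd f x = ∑' y, (m x y : ℂ) * f y := rfl

end Matrix

/-! ### The adjacency operator -/

section Adjacency

variable {α β : Type*} {G : Graph α β}

theorem edgeCount_symm (x y : V(G)) : edgeCount G x y = edgeCount G y x := by
  unfold edgeCount
  congr 1
  ext e
  exact G.isLink_comm

theorem incidence_bound (hG : HasBoundedDegree G) (x : V(G)) :
    (G.incidenceSet (x : α)).encard ≤ ((⨆ x : V(G), degree G x).toNat : ℕ∞) := by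
  rw [ENat.natCast_toNat hG.ne]
  exact le_self_add.trans (le_iSup (degree G) x)

theorem sum_edgeCount_le (hG : HasBoundedDegree G) (x : V(G)) (s : Finset V(G)) :
    ∑ y ∈ s, edgeCount G x y ≤ (⨆ x : V(G), degree G x).toNat := by
  have hfin : (G.incidenceSet (x : α)).Finite :=
    Set.finite_of_encard_le_coe (incidence_bound hG x)
  have hsub : ∀ y : V(G), {e | G.IsLink e (x : α) (y : α)} ⊆ G.incidenceSet (x : α) :=
    fun y e he => ⟨y, he⟩
  have key : (⋃ y ∈ s, {e | G.IsLink e (x : α) (y : α)}).ncard = ∑ y ∈ s, edgeCount G x y := by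
    classical
    induction s using Finset.induction_on with
    | empty => simp
    | insert a s ha ih =>
      rw [Finset.sum_insert ha, Finset.set_biUnion_insert, Set.ncard_union_eq ?_ (hfin.subset (hsub a))
        (hfin.subset (Set.iUnion₂_subset fun y _ => hsub y)), ih, edgeCount]
      · rw [Set.disjoint_left]
        intro e he he'
        simp only [Set.mem_iUnion] at he'
        obtain ⟨y, hy, hey⟩ := he'
        have : a = y := Subtype.ext (Graph.IsLink.right_unique he hey)
        exact ha (this ▸ hy)
  rw [← key]
  have h1 : (⋃ y ∈ s, {e | G.IsLink e (x : α) (y : α)}).ncard ≤ (G.incidenceSet (x : α)).ncard :=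
    Set.ncard_le_ncard (Set.iUnion₂_subset fun y _ => hsub y) hfin
  refine h1.trans ?_
  have h2 := incidence_bound hG x
  rw [← hfin.cast_ncard_eq] at h2
  exact_mod_cast h2

/-- The adjacency operator `A_X` of a graph with bounded degree: the bounded operator on
`ℓ²(V(G))` with matrix entries `⟨δ_x, A_X δ_y⟩ = |E_{x,y}|`. -/
def adjacencyOperator (G : Graph α β) (hG : HasBoundedDegree G) : L2 V(G) →L[ℂ] L2 V(G) :=
  matrixOperator (m := edgeCount G) edgeCount_symm (sum_edgeCount_le hG)

theorem inner_delta_adjacencyOperator (hG : HasBoundedDegree G) (x y : V(G)) :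
    ⟪delta x, adjacencyOperator G hG (delta y)⟫_ℂ = edgeCount G x y := by
  rw [inner_delta_left, adjacencyOperator, matrixOperator_apply, tsum_eq_single y]
  · simp [delta_apply_self]
  · intro z hz
    simp [delta_apply_ne hz]

end Adjacency

/-! ### Bounded operators on a complex Hilbert space -/

section General

variable {E : Type*} [NormedAddCommGroup E] [InnerProductSpace ℂ E] [CompleteSpace E]

/-- The Hamiltonian `‖A‖ 1 - A`. -/
def hamiltonian (A : E →L[ℂ] E) : E →L[ℂ] E :=
  (‖A‖ : ℂ) • (1 : E →L[ℂ] E) - A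

/-- The bounded operator `e^{zH}`. -/
def expOp (z : ℂ) (H : E →L[ℂ] E) : E →L[ℂ] E :=
  NormedSpace.exp (z • H)

/-- The (in general unbounded) operator `B^{-1/2}` of a bounded positive operator `B`: the inverse
of the positive square root of `B`. Its domain is the range of that square root. -/
def invSqrt (B : E →L[ℂ] E) : E →ₗ.[ℂ] E :=
  LinearPMap.inverse ((CFC.sqrt B : E →L[ℂ] E).toLinearMap.toPMap ⊤)

theorem mem_invSqrt_domain (B : E →L[ℂ] E) (u : E) :
    u ∈ (invSqrt B).domain ↔ ∃ w, CFC.sqrt B w = u := by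
  rw [invSqrt, LinearPMap.inverse_domain]
  constructor
  · rintro ⟨w, hw⟩
    exact ⟨w, hw⟩
  · rintro ⟨w, hw⟩
    exact ⟨⟨w, trivial⟩, hw⟩

end General

/-! ### Transience, Perron–Frobenius weights and the space `𝔥₂` -/

section Operators

variable {V : Type*}

/-- The limit of `⟨δ_x, (l - A)⁻¹ δ_x⟩` as `l` decreases to `‖A‖` exists and is finite,
for every `x`. -/
def IsTransient (A : L2 V →L[ℂ] L2 V) : Prop :=
  ∀ x : V, ∃ c : ℝ,
    Tendsto (fun l : ℝ => ⟪delta x, resolvent A (l : ℂ) (delta x)⟫_ℂ) (𝓝[>] ‖A‖) (𝓝 (c : ℂ))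

/-- A Perron–Frobenius weight for `B`: a (not necessarily square summable) family of strictly
positive numbers with `∑_y ⟨δ_x, B δ_y⟩ v(y) = ‖B‖ v(x)` for all `x`. -/
def IsPerronFrobeniusWeight (B : L2 V →L[ℂ] L2 V) (v : V → ℝ) : Prop :=
  (∀ x, 0 < v x) ∧
    ∀ x, HasSum (fun y => ⟪delta x, B (delta y)⟫_ℂ * (v y : ℂ)) ((‖B‖ * v x : ℝ) : ℂ)

/-- The vector `∫ p(t) e^{-(t-a)²/b} e^{itH} δ_x dt` (a Bochner integral in `ℓ²`). -/
def gaussianAverage (H : L2 V →L[ℂ] L2 V) (p : Polynomial ℂ) (a b : ℝ) (x : V) : L2 V :=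
  ∫ t : ℝ, (p.eval (t : ℂ) * (Real.exp (-(t - a) ^ 2 / b) : ℂ)) •
    expOp (Complex.I * t) H (delta x)

/-- The linear span of all Gaussian-times-polynomial time averages of the `e^{itH} δ_x`. -/
def frakH2 (H : L2 V →L[ℂ] L2 V) : Submodule ℂ (L2 V) :=
  Submodule.span ℂ
    {u | ∃ (p : Polynomial ℂ) (a b : ℝ) (x : V), 0 < b ∧ u = gaussianAverage H p a b x}

/-- The pairing `⟨u, v⟩ = ∑_x conj(u(x)) v(x)` of `u ∈ ℓ²` with a real family `v`. It is
meaningful when `∑_x |u(x)| |v(x)| < ∞`. -/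
def pairing (u : L2 V) (v : V → ℝ) : ℂ :=
  ∑' x, (starRingEnd ℂ) (u x) * (v x : ℂ)

end Operators

end GraphBEC

end

noncomputable section

namespace GraphBEC

/-! ### The exponential series of a bounded operator. -/

section Exponential

variable {E : Type*} [NormedAddCommGroup E] [InnerProductSpace ℂ E] [CompleteSpace E]

/-! Claim 1: `e^{isH}` passes under the Bochner integral, and a translation of `t` absorbs it into a
shifted polynomial and centre (`expOp_gaussianAverage`).

Claim 2: put `B = e^{βH} - 1`. Cauchy–Schwarz for the positive form of `l - A`, with `l` decreasing
to `‖A‖`, turns transience into `|⟪δ_x, y⟫|² ≤ c ⟪y, H y⟫`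
(`norm_inner_sq_le_of_tendsto_resolvent`). Since `βH ≤ B`, this bounds `|⟪δ_x, y⟫|` by a multiple of
`‖B^{1/2} y‖`, so Riesz representation puts `δ_x` in the range of `B^{1/2}`
(`exists_sqrt_apply_eq`). As `B^{1/2}` commutes with every `e^{zH}`, Gaussian averages and their
images under `e^{βH}` stay in that range.

Claim 3: symmetry of the matrix and the eigenvalue equation for `v` make `A` bounded by `‖A‖` in the
`v`-weighted `ℓ¹` norm. Hence `e^{itH} δ_x` grows at most exponentially there, and the Gaussian
absorbs this (`weightedNorm_gaussianAverage_ne_top`). The sum of `(H f)(x) v(x)` vanishes whenever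
the weighted norm of `f` is finite, so only the zeroth term of the exponential series contributes to
the pairing (`tsum_expOp_mul`). -/

theorem hasSum_expOp_apply (z : ℂ) (H : E →L[ℂ] E) (w : E) :
    HasSum (fun n : ℕ => ((n.factorial : ℂ)⁻¹ * z ^ n) • (H ^ n) w) (expOp z H w) := by
  have h := NormedSpace.exp_series_hasSum_exp' (𝕂 := ℂ) (z • H)
  have h2 := h.mapL (ContinuousLinearMap.apply ℂ E w)
  simpa [smul_pow, smul_smul, expOp] using h2

theorem norm_pow_apply_le {E : Type*} [NormedAddCommGroup E] [NormedSpace ℂ E] (H : E →L[ℂ] E) (w : E) (n : ℕ) :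
    ‖(H ^ n) w‖ ≤ ‖H‖ ^ n * ‖w‖ := by
  induction n with
  | zero => simp
  | succ n ih =>
    rw [pow_succ', mul_apply_eq_comp, pow_succ', mul_assoc]
    exact (H.le_opNorm _).trans (by gcongr)

theorem hasSum_real_exp (x : ℝ) :
    HasSum (fun n : ℕ => (n.factorial : ℝ)⁻¹ * x ^ n) (Real.exp x) := by
  have h := NormedSpace.exp_series_hasSum_exp' (𝕂 := ℝ) x
  rwa [← Real.exp_eq_exp_ℝ] at h

theorem norm_expOp_apply_le (z : ℂ) (H : E →L[ℂ] E) (w : E) :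
    ‖expOp z H w‖ ≤ Real.exp (‖H‖ * ‖z‖) * ‖w‖ := by
  refine (hasSum_expOp_apply z H w).norm_le_of_bounded
    ((hasSum_real_exp (‖H‖ * ‖z‖)).mul_right ‖w‖) fun n => ?_
  rw [norm_smul, norm_mul, norm_inv, norm_pow, Complex.norm_natCast, mul_pow]
  calc _ ≤ (n.factorial : ℝ)⁻¹ * ‖z‖ ^ n * (‖H‖ ^ n * ‖w‖) := by
        gcongr
        exact norm_pow_apply_le H w n
    _ = _ := by ring

theorem continuous_expOp_apply (H : E →L[ℂ] E) (w : E) :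
    Continuous fun t : ℝ => expOp (Complex.I * t) H w := by
  have h : Continuous fun t : ℝ => expOp (Complex.I * t) H :=
    let _ : NormedAlgebra ℚ (E →L[ℂ] E) := NormedAlgebra.restrictScalars ℚ ℂ _
    (NormedSpace.exp_continuous (𝔸 := E →L[ℂ] E)).comp (by fun_prop)
  exact h.clm_apply continuous_const

theorem expOp_add (z w : ℂ) (H : E →L[ℂ] E) :
    expOp (z + w) H = expOp z H * expOp w H := by
  let _ : NormedAlgebra ℚ (E →L[ℂ] E) := NormedAlgebra.restrictScalars ℚ ℂ _
  rw [expOp, add_smul]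
  exact NormedSpace.exp_add_of_commute (((Commute.refl H).smul_left z).smul_right w)

theorem expOp_zero (H : E →L[ℂ] E) : expOp 0 H = 1 := by
  simp [expOp]

end Exponential

/-! ### Gaussian time averages and invariance under the evolution. -/

section Gaussian

theorem exists_norm_eval_le (p : Polynomial ℂ) :
    ∃ C : ℝ, ∀ t : ℝ, ‖p.eval (t : ℂ)‖ ≤ C * Real.exp |t| := by
  induction p using Polynomial.induction_on' with
  | add p q hp hq =>
    obtain ⟨C, hC⟩ := hp
    obtain ⟨D, hD⟩ := hq
    refine ⟨C + D, fun t => ?_⟩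
    rw [Polynomial.eval_add, add_mul]
    exact (norm_add_le _ _).trans (add_le_add (hC t) (hD t))
  | monomial n a =>
    refine ⟨‖a‖ * n.factorial, fun t => ?_⟩
    have h := Real.pow_div_factorial_le_exp |t| (abs_nonneg t) n
    rw [div_le_iff₀ (by positivity)] at h
    rw [Polynomial.eval_monomial, norm_mul, norm_pow, Complex.norm_real, Real.norm_eq_abs,
      mul_assoc]
    gcongr
    linarith

theorem integrable_gaussian_mul_exp (a b c : ℝ) (hb : 0 < b) :
    MeasureTheory.Integrable fun t : ℝ => Real.exp (-(t - a) ^ 2 / b) * Real.exp (c * t) := by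
  have h := (integrable_cexp_quadratic (b := ((1 / b : ℝ) : ℂ)) (by rw [Complex.ofReal_re]; positivity)
    ((2 * a / b + c : ℝ) : ℂ) ((-a ^ 2 / b : ℝ) : ℂ)).norm
  refine h.congr (Eventually.of_forall fun t => ?_)
  dsimp only
  rw [Complex.norm_exp, ← Real.exp_add]
  congr 1
  have : -((1 / b : ℝ) : ℂ) * (t : ℂ) ^ 2 + ((2 * a / b + c : ℝ) : ℂ) * t + ((-a ^ 2 / b : ℝ) : ℂ)
      = ((-(1 / b) * t ^ 2 + (2 * a / b + c) * t + -a ^ 2 / b : ℝ) : ℂ) := by push_cast; ring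
  rw [this, Complex.ofReal_re]
  field_simp
  ring

theorem integrable_polynomial_gaussian (p : Polynomial ℂ) (a b c : ℝ) (hb : 0 < b) :
    MeasureTheory.Integrable fun t : ℝ =>
      ‖p.eval (t : ℂ) * (Real.exp (-(t - a) ^ 2 / b) : ℂ)‖ * Real.exp (c * |t|) := by
  obtain ⟨C, hC⟩ := exists_norm_eval_le p
  refine (((integrable_gaussian_mul_exp a b (c + 1) hb).add
    (integrable_gaussian_mul_exp a b (-(c + 1)) hb)).const_mul C).mono' ?_
    (Eventually.of_forall fun t => ?_)
  · apply Continuous.aestronglyMeasurable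
    fun_prop
  · have hC0 : 0 ≤ C := by simpa using (norm_nonneg _).trans (hC 0)
    -- Summing the exponentials of both signs removes `|t|`, leaving integrands covered by the exact
    -- Gaussian formula.
    have h1 : Real.exp |t| * Real.exp (c * |t|)
        ≤ Real.exp ((c + 1) * t) + Real.exp (-(c + 1) * t) := by
      rw [← Real.exp_add]
      rcases abs_cases t with ⟨h, -⟩ | ⟨h, -⟩ <;> rw [h]
      · rw [show t + c * t = (c + 1) * t by ring]
        exact le_add_of_nonneg_right (Real.exp_nonneg _)
      · rw [show -t + c * -t = -(c + 1) * t by ring]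
        exact le_add_of_nonneg_left (Real.exp_nonneg _)
    rw [Real.norm_of_nonneg (by positivity), norm_mul, Complex.norm_real, Real.norm_of_nonneg
      (Real.exp_nonneg _)]
    calc _ ≤ C * Real.exp |t| * Real.exp (-(t - a) ^ 2 / b) * Real.exp (c * |t|) := by
          gcongr
          exact hC t
      _ = C * (Real.exp (-(t - a) ^ 2 / b) * (Real.exp |t| * Real.exp (c * |t|))) := by ring
      _ ≤ C * (Real.exp (-(t - a) ^ 2 / b) *
            (Real.exp ((c + 1) * t) + Real.exp (-(c + 1) * t))) := by gcongr
      _ = _ := by rw [Pi.add_apply, mul_add]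

variable {E : Type*} [NormedAddCommGroup E] [InnerProductSpace ℂ E] [CompleteSpace E]

theorem integrable_polynomial_gaussian_smul_expOp (H : E →L[ℂ] E) (p : Polynomial ℂ) (a b : ℝ)
    (hb : 0 < b) (w : E) :
    MeasureTheory.Integrable fun t : ℝ =>
      (p.eval (t : ℂ) * (Real.exp (-(t - a) ^ 2 / b) : ℂ)) • expOp (Complex.I * t) H w := by
  refine ((integrable_polynomial_gaussian p a b ‖H‖ hb).mul_const ‖w‖).mono' ?_
    (Eventually.of_forall fun t => ?_)
  · apply Continuous.aestronglyMeasurable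
    have := continuous_expOp_apply H w
    fun_prop
  · rw [norm_smul, mul_assoc]
    gcongr
    simpa using norm_expOp_apply_le (Complex.I * t) H w

variable {V : Type*}

theorem expOp_gaussianAverage (H : L2 V →L[ℂ] L2 V) (p : Polynomial ℂ) (a b : ℝ) (hb : 0 < b)
    (x : V) (s : ℝ) :
    expOp (Complex.I * s) H (gaussianAverage H p a b x)
      = gaussianAverage H (p.comp (Polynomial.X - Polynomial.C (s : ℂ))) (a + s) b x := by
  rw [gaussianAverage, gaussianAverage, ← ContinuousLinearMap.integral_comp_comm _
    (integrable_polynomial_gaussian_smul_expOp H p a b hb _)]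
  -- After `t ↦ t + s` the shifts of the polynomial and of the centre cancel, and only the factor
  -- `e^{isH}` remains.
  conv_rhs => rw [← MeasureTheory.integral_add_right_eq_self _ s]
  congr 1
  ext1 t
  rw [map_smul, ← mul_apply_eq_comp, ← expOp_add, ← mul_add]
  simp [add_comm (s : ℂ)]

theorem map_frakH2_le (H : L2 V →L[ℂ] L2 V) (s : ℝ) :
    (frakH2 H).map (expOp (Complex.I * s) H).toLinearMap ≤ frakH2 H := by
  rw [frakH2, Submodule.map_span, Submodule.span_le]
  rintro _ ⟨_, ⟨p, a, b, x, hb, rfl⟩, rfl⟩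
  exact Submodule.subset_span ⟨_, _, b, x, hb, expOp_gaussianAverage H p a b hb x s⟩

theorem map_frakH2 (H : L2 V →L[ℂ] L2 V) (s : ℝ) :
    (frakH2 H).map (expOp (Complex.I * s) H).toLinearMap = frakH2 H := by
  refine le_antisymm (map_frakH2_le H s) fun u hu => ?_
  refine ⟨expOp (Complex.I * (-s : ℝ)) H u, map_frakH2_le H (-s) ⟨u, hu, rfl⟩, ?_⟩
  change expOp (Complex.I * s) H (expOp (Complex.I * (-s : ℝ)) H u) = u
  rw [← mul_apply_eq_comp, ← expOp_add]
  simp [expOp_zero]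

end Gaussian

/-! ### Operator inequalities and the range of the square root. -/

theorem add_one_le_exp_of_isSelfAdjoint {R : Type*} [CStarAlgebra R] [PartialOrder R]
    [StarOrderedRing R] {a : R} (ha : IsSelfAdjoint a) : a + 1 ≤ NormedSpace.exp a := by
  rw [← CFC.real_exp_eq_normedSpace_exp ha]
  have h1 : cfc (fun x : ℝ => x + 1) a ≤ cfc Real.exp a :=
    cfc_mono (fun x _ => Real.add_one_le_exp x)
  rwa [cfc_add_const (1 : ℝ) (fun x => x) a, cfc_id' ℝ a, map_one] at h1

section Range

variable {E : Type*} [NormedAddCommGroup E] [InnerProductSpace ℂ E] [CompleteSpace E]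

/-- A vector `d` with `|⟪d, y⟫| ≤ C ‖S y‖` for all `y` lies in the range of the self-adjoint `S`. -/
theorem exists_apply_eq_of_norm_inner_le {S : E →L[ℂ] E} (hS : IsSelfAdjoint S) {d : E} {C : ℝ}
    (h : ∀ y, ‖⟪d, y⟫_ℂ‖ ≤ C * ‖S y‖) : ∃ w, S w = d := by
  let f : E →ₗ[ℂ] ℂ := (innerSL ℂ d).toLinearMap
  have hker : S.toLinearMap.ker ≤ f.ker := by
    intro y hy
    have hy' : S y = 0 := hy
    have := h y
    rw [hy', norm_zero, mul_zero] at this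
    simpa [f] using this
  let g : S.toLinearMap.range →ₗ[ℂ] ℂ :=
    (S.toLinearMap.ker.liftQ f hker) ∘ₗ S.toLinearMap.quotKerEquivRange.symm.toLinearMap
  have hg : ∀ y, g ⟨S y, y, rfl⟩ = ⟪d, y⟫_ℂ := by
    intro y
    have : S.toLinearMap.quotKerEquivRange.symm ⟨S y, y, rfl⟩ = Submodule.Quotient.mk y := by
      rw [LinearEquiv.symm_apply_eq]
      rfl
    simp [g, this, f]
  let g' : StrongDual ℂ S.toLinearMap.range := g.mkContinuous C (by
    rintro ⟨_, y, rfl⟩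
    exact (congrArg norm (hg y)).le.trans (h y))
  obtain ⟨k, hk, -⟩ := exists_extension_norm_eq S.toLinearMap.range g'
  refine ⟨(InnerProductSpace.toDual ℂ E).symm k, ?_⟩
  refine ext_inner_right ℂ fun y => ?_
  have h1 : ⟪S ((InnerProductSpace.toDual ℂ E).symm k), y⟫_ℂ
      = ⟪(InnerProductSpace.toDual ℂ E).symm k, S y⟫_ℂ := by
    rw [← ContinuousLinearMap.adjoint_inner_right, hS.adjoint_eq]
  rw [h1, InnerProductSpace.toDual_symm_apply]
  exact (hk ⟨S y, y, rfl⟩).trans (hg y)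

theorem norm_sqrt_apply_sq {T : E →L[ℂ] E} (hT : 0 ≤ T) (y : E) :
    ‖CFC.sqrt T y‖ ^ 2 = (⟪y, T y⟫_ℂ).re := by
  have hS : IsSelfAdjoint (CFC.sqrt T) := (CFC.sqrt_nonneg T).isSelfAdjoint
  have h : ⟪y, T y⟫_ℂ = ⟪CFC.sqrt T y, CFC.sqrt T y⟫_ℂ := by
    conv_lhs => rw [← CFC.sqrt_mul_sqrt_self T hT, mul_apply_eq_comp,
      ← ContinuousLinearMap.adjoint_inner_left, hS.adjoint_eq]
  rw [h, inner_self_eq_norm_sq_to_K]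
  norm_cast

/-- Cauchy–Schwarz applied to `T^{1/2} z` and `T^{1/2} y`. -/
theorem norm_inner_sq_le_of_nonneg {T : E →L[ℂ] E} (hT : 0 ≤ T) (z y : E) :
    ‖⟪T z, y⟫_ℂ‖ ^ 2 ≤ (⟪z, T z⟫_ℂ).re * (⟪y, T y⟫_ℂ).re := by
  have hS : IsSelfAdjoint (CFC.sqrt T) := (CFC.sqrt_nonneg T).isSelfAdjoint
  have h : ⟪T z, y⟫_ℂ = ⟪CFC.sqrt T z, CFC.sqrt T y⟫_ℂ := by
    conv_lhs => rw [← CFC.sqrt_mul_sqrt_self T hT, mul_apply_eq_comp,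
      ← ContinuousLinearMap.adjoint_inner_right, hS.adjoint_eq]
  rw [h, ← norm_sqrt_apply_sq hT, ← norm_sqrt_apply_sq hT, ← mul_pow]
  gcongr
  exact norm_inner_le_norm _ _

theorem isSelfAdjoint_hamiltonian {A : E →L[ℂ] E} (hA : IsSelfAdjoint A) :
    IsSelfAdjoint (hamiltonian A) := by
  refine IsSelfAdjoint.sub ?_ hA
  exact IsSelfAdjoint.smul (by simp [isSelfAdjoint_iff]) (IsSelfAdjoint.one _)

theorem hamiltonian_nonneg {A : E →L[ℂ] E} (hA : IsSelfAdjoint A) : 0 ≤ hamiltonian A := by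
  rw [hamiltonian, sub_nonneg]
  have h := hA.le_algebraMap_norm_self
  rwa [Algebra.algebraMap_eq_smul_one, ← Complex.coe_smul] at h

theorem smul_le_expOp_sub_one {H : E →L[ℂ] E} (hH : IsSelfAdjoint H) (b : ℝ) :
    (b : ℂ) • H ≤ expOp b H - 1 := by
  have ha : IsSelfAdjoint (b • H) := (IsSelfAdjoint.all b).smul hH
  rw [expOp, Complex.coe_smul]
  exact le_sub_iff_add_le.2 (add_one_le_exp_of_isSelfAdjoint ha)

theorem norm_inner_sq_le_of_tendsto_resolvent {A : E →L[ℂ] E} (hA : IsSelfAdjoint A) {d : E} {c : ℝ}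
    (h : Tendsto (fun l : ℝ => ⟪d, resolvent A (l : ℂ) d⟫_ℂ) (𝓝[>] ‖A‖) (𝓝 (c : ℂ))) (y : E) :
    ‖⟪d, y⟫_ℂ‖ ^ 2 ≤ c * (⟪y, hamiltonian A y⟫_ℂ).re := by
  have h1 : Tendsto (fun l : ℝ => (⟪d, resolvent A (l : ℂ) d⟫_ℂ).re) (𝓝[>] ‖A‖) (𝓝 c) := 
    (Complex.continuous_re.tendsto _).comp h
  have h2 : Tendsto (fun l : ℝ => (⟪y, ((l : ℂ) • (1 : E →L[ℂ] E) - A) y⟫_ℂ).re) (𝓝[>] ‖A‖)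
      (𝓝 (⟪y, hamiltonian A y⟫_ℂ).re) := by
    have : Continuous fun l : ℝ => (⟪y, ((l : ℂ) • (1 : E →L[ℂ] E) - A) y⟫_ℂ).re := by
      simp only [sub_apply, smul_apply,
        one_apply_eq_self]
      fun_prop
    exact (this.tendsto ‖A‖).mono_left nhdsWithin_le_nhds
  refine ge_of_tendsto (h1.mul h2) ?_
  filter_upwards [self_mem_nhdsWithin] with l hl
  rw [Set.mem_Ioi] at hl
  have hl0 : 0 < l := (norm_nonneg A).trans_lt hl
  set T : E →L[ℂ] E := (l : ℂ) • (1 : E →L[ℂ] E) - A with hTdef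
  have hT : 0 ≤ T := by
    have h3 : T = hamiltonian A + (l - ‖A‖) • (1 : E →L[ℂ] E) := by
      rw [hTdef, hamiltonian, sub_smul, ← Complex.coe_smul, ← Complex.coe_smul]
      abel
    rw [h3]
    exact add_nonneg (hamiltonian_nonneg hA) (smul_nonneg (by linarith) zero_le_one)
  have hu : (l : ℂ) ∈ resolventSet ℂ A := by
    refine spectrum.mem_resolventSet_of_norm_lt_mul ?_
    rw [Complex.norm_real, Real.norm_of_nonneg hl0.le]
    exact (mul_le_of_le_one_right (norm_nonneg A) ContinuousLinearMap.norm_id_le).trans_lt hl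
  have hu' : IsUnit T := by
    rw [spectrum.mem_resolventSet_iff, Algebra.algebraMap_eq_smul_one] at hu
    exact hu
  have hR : T (resolvent A (l : ℂ) d) = d := by
    rw [resolvent, Algebra.algebraMap_eq_smul_one, ← mul_apply_eq_comp,
      Ring.mul_inverse_cancel _ hu', one_apply_eq_self]
  -- With `z = T⁻¹ d` the left side is `⟪d, y⟫` and the first factor is the resolvent entry, whose
  -- limit is `c`.
  have h4 := norm_inner_sq_le_of_nonneg hT (resolvent A (l : ℂ) d) y
  rw [hR, ← inner_conj_symm (resolvent A (l : ℂ) d), Complex.conj_re] at h4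
  exact h4

theorem commute_sqrt_expOp {H : E →L[ℂ] E} (b : ℝ) (z : ℂ) :
    Commute (CFC.sqrt (expOp b H - 1)) (expOp z H) := by
  refine Commute.cfcₙ_nnreal ?_ _
  refine Commute.sub_left ?_ (Commute.one_left _)
  rw [commute_iff_eq, ← expOp_add, ← expOp_add, add_comm]

theorem exists_sqrt_apply_eq {A : E →L[ℂ] E} (hA : IsSelfAdjoint A) {d : E} {c : ℝ}
    (h : Tendsto (fun l : ℝ => ⟪d, resolvent A (l : ℂ) d⟫_ℂ) (𝓝[>] ‖A‖) (𝓝 (c : ℂ)))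
    {b : ℝ} (hb : 0 < b) :
    ∃ w, CFC.sqrt (expOp b (hamiltonian A) - 1) w = d := by
  set H := hamiltonian A
  set B := expOp b H - 1
  have hHB : (b : ℂ) • H ≤ B := smul_le_expOp_sub_one (isSelfAdjoint_hamiltonian hA) b
  have hB : 0 ≤ B := by
    refine le_trans ?_ hHB
    rw [Complex.coe_smul]
    exact smul_nonneg hb.le (hamiltonian_nonneg hA)
  -- The absolute value avoids having to prove `0 ≤ c`; dividing by `b` compensates for `b H ≤ B`.
  refine exists_apply_eq_of_norm_inner_le (C := Real.sqrt (|c| / b))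
    (CFC.sqrt_nonneg B).isSelfAdjoint fun y => ?_
  refine abs_le_of_sq_le_sq' ?_ (by positivity) |>.2
  rw [mul_pow, Real.sq_sqrt (by positivity), norm_sqrt_apply_sq hB]
  have h1 := norm_inner_sq_le_of_tendsto_resolvent hA h y
  have h2 : b * (⟪y, H y⟫_ℂ).re ≤ (⟪y, B y⟫_ℂ).re := by
    have := ((ContinuousLinearMap.le_def _ _).1 hHB).re_inner_nonneg_right y
    rw [sub_apply, inner_sub_right, smul_apply, inner_smul_right, map_sub, sub_nonneg] at this
    simpa using this
  have h3 : 0 ≤ (⟪y, H y⟫_ℂ).re := by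
    have := ((ContinuousLinearMap.nonneg_iff_isPositive _).1
      (hamiltonian_nonneg hA)).re_inner_nonneg_right y
    simpa using this
  calc _ ≤ c * (⟪y, H y⟫_ℂ).re := h1
    _ ≤ |c| * (⟪y, H y⟫_ℂ).re := by gcongr; exact le_abs_self c
    _ = |c| / b * (b * (⟪y, H y⟫_ℂ).re) := by field_simp
    _ ≤ _ := by gcongr

variable {V : Type*}

theorem expOp_mem_invSqrt_domain {A : L2 V →L[ℂ] L2 V} (hA : IsSelfAdjoint A)
    (htrans : IsTransient A) {b : ℝ} (hb : 0 < b) {u : L2 V} (hu : u ∈ frakH2 (hamiltonian A)) :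
    expOp b (hamiltonian A) u ∈ (invSqrt (expOp b (hamiltonian A) - 1)).domain := by
  set H := hamiltonian A
  suffices hle : frakH2 H ≤ ((invSqrt (expOp b H - 1)).domain).comap (expOp b H).toLinearMap from
    hle hu
  rw [frakH2, Submodule.span_le]
  rintro _ ⟨p, a, b', x, hb', rfl⟩
  obtain ⟨c, hc⟩ := htrans x
  obtain ⟨w, hw⟩ := exists_sqrt_apply_eq hA hc hb
  change expOp b H (gaussianAverage H p a b' x) ∈ (invSqrt (expOp b H - 1)).domain
  rw [mem_invSqrt_domain]
  -- The preimage is the same average, with `δ_x` replaced by its own preimage `w`.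
  refine ⟨expOp b H (∫ t : ℝ, (p.eval (t : ℂ) * (Real.exp (-(t - a) ^ 2 / b') : ℂ)) •
    expOp (Complex.I * t) H w), ?_⟩
  rw [← mul_apply_eq_comp, (commute_sqrt_expOp b b).eq, mul_apply_eq_comp,
    ← ContinuousLinearMap.integral_comp_comm _
      (integrable_polynomial_gaussian_smul_expOp H p a b' hb' w), gaussianAverage]
  congr 2
  ext1 t
  rw [map_smul, ← mul_apply_eq_comp, (commute_sqrt_expOp b _).eq,
    mul_apply_eq_comp, hw]

end Range

/-! ### Self-adjointness of the adjacency operator. -/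

section Adjacency

variable {α β : Type*} {G : Graph α β}

theorem isSelfAdjoint_adjacencyOperator (hG : HasBoundedDegree G) :
    IsSelfAdjoint (adjacencyOperator G hG) := by
  classical
  rw [ContinuousLinearMap.isSelfAdjoint_iff']
  refine lp.ext_continuousLinearMap (by norm_num) fun y => ?_
  refine ContinuousLinearMap.ext_ring ?_
  have hy : lp.singleContinuousLinearMap ℂ (fun _ : V(G) => ℂ) 2 y 1 = delta y := by
    rw [lp.singleContinuousLinearMap_apply, delta]
    congr!
  rw [ContinuousLinearMap.comp_apply, ContinuousLinearMap.comp_apply, hy]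
  ext x
  rw [← inner_delta_left, ← inner_delta_left, ContinuousLinearMap.adjoint_inner_right,
    ← inner_conj_symm, inner_delta_adjacencyOperator, inner_delta_adjacencyOperator,
    edgeCount_symm]
  simp

end Adjacency

/-! ### The weighted `ℓ¹` norm and the pairing with a weight. -/

section Weighted

open scoped ENNReal

variable {V : Type*}

theorem enorm_ofReal_of_nonneg {r : ℝ} (hr : 0 ≤ r) : ‖(r : ℂ)‖ₑ = ENNReal.ofReal r := by
  rw [← ofReal_norm, Complex.norm_real, Real.norm_of_nonneg hr]

/-- The weighted `ℓ¹`-norm `∑_x |f(x) v(x)|`. -/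
def weightedNorm (v : V → ℝ) (f : V → ℂ) : ℝ≥0∞ := ∑' x, ‖f x * (v x : ℂ)‖ₑ

theorem summable_of_weightedNorm_ne_top {v : V → ℝ} {f : V → ℂ} (h : weightedNorm v f ≠ ∞) :
    Summable fun x => f x * (v x : ℂ) :=
  (tsum_enorm_ne_top_iff_summable_norm.1 h).of_norm

theorem summable_norm_mul_of_weightedNorm_ne_top {v : V → ℝ} (hv : ∀ x, 0 < v x) {f : V → ℂ}
    (h : weightedNorm v f ≠ ∞) : Summable fun x => ‖f x‖ * v x := by
  refine (tsum_enorm_ne_top_iff_summable_norm.1 h).congr fun x => ?_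
  rw [norm_mul, Complex.norm_real, Real.norm_of_nonneg (hv x).le]

theorem weightedNorm_add_le (v : V → ℝ) (f g : V → ℂ) :
    weightedNorm v (f + g) ≤ weightedNorm v f + weightedNorm v g := by
  rw [weightedNorm, weightedNorm, weightedNorm, ← ENNReal.tsum_add]
  refine ENNReal.tsum_le_tsum fun x => ?_
  rw [Pi.add_apply, add_mul]
  exact enorm_add_le _ _

theorem weightedNorm_smul (v : V → ℝ) (c : ℂ) (f : V → ℂ) :
    weightedNorm v (c • f) = ‖c‖ₑ * weightedNorm v f := by
  rw [weightedNorm, weightedNorm, ← ENNReal.tsum_mul_left]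
  congr 1
  ext1 x
  rw [Pi.smul_apply, smul_eq_mul, mul_assoc, enorm_mul]

theorem weightedNorm_delta (v : V → ℝ) (x : V) : weightedNorm v (delta x) = ‖(v x : ℂ)‖ₑ := by
  rw [weightedNorm, tsum_eq_single x]
  · simp [delta_apply_self]
  · intro y hy
    simp [delta_apply_ne hy]

theorem weightedNorm_integral_le [Countable V] (v : V → ℝ) {F : ℝ → L2 V}
    (hF : MeasureTheory.Integrable F) :
    weightedNorm v (∫ t, F t : L2 V) ≤ ∫⁻ t, weightedNorm v (F t) := by
  have hx : ∀ x, MeasureTheory.Integrable fun t => F t x := fun x =>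
    (lp.evalCLM ℂ (fun _ : V => ℂ) (p := 2) x).integrable_comp hF
  simp only [weightedNorm]
  rw [MeasureTheory.lintegral_tsum fun x => ((hx x).mul_const _).aestronglyMeasurable.enorm]
  refine ENNReal.tsum_le_tsum fun x => ?_
  have h : (∫ t, F t : L2 V) x = ∫ t, F t x :=
    ((lp.evalCLM ℂ (fun _ : V => ℂ) (p := 2) x).integral_comp_comm hF).symm
  rw [h, ← MeasureTheory.integral_mul_const]
  exact MeasureTheory.enorm_integral_le_lintegral_enorm _

section Exponential

variable {v : V → ℝ} {H : L2 V →L[ℂ] L2 V} {K : ℝ}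

theorem hasSum_expOp_apply_apply (z : ℂ) (H : L2 V →L[ℂ] L2 V) (f : L2 V) (x : V) :
    HasSum (fun n : ℕ => ((n.factorial : ℂ)⁻¹ * z ^ n) * (H ^ n) f x) (expOp z H f x) :=
  (hasSum_expOp_apply z H f).mapL (lp.evalCLM ℂ (fun _ : V => ℂ) (p := 2) x)

theorem weightedNorm_pow_le
    (hN : ∀ f : L2 V, weightedNorm v (H f) ≤ ENNReal.ofReal K * weightedNorm v f)
    (f : L2 V) (n : ℕ) :
    weightedNorm v ((H ^ n) f) ≤ ENNReal.ofReal K ^ n * weightedNorm v f := by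
  induction n with
  | zero => simp
  | succ n ih =>
    rw [pow_succ', mul_apply_eq_comp, pow_succ', mul_assoc]
    exact (hN _).trans (by gcongr)

/-- Keeping the double sum serves twice: it bounds the norm of `e^{zH} f` and justifies Fubini in
`tsum_expOp_mul`. -/
theorem tsum_weightedNorm_expSeries_le (hK : 0 ≤ K)
    (hN : ∀ f : L2 V, weightedNorm v (H f) ≤ ENNReal.ofReal K * weightedNorm v f)
    (z : ℂ) (f : L2 V) :
    ∑' n : ℕ, ∑' x, ‖((n.factorial : ℂ)⁻¹ * z ^ n) * (H ^ n) f x * (v x : ℂ)‖ₑ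
      ≤ ENNReal.ofReal (Real.exp (K * ‖z‖)) * weightedNorm v f := by
  have h1 := hasSum_real_exp (K * ‖z‖)
  rw [← h1.tsum_eq, ENNReal.ofReal_tsum_of_nonneg (fun n => by positivity) h1.summable,
    ← ENNReal.tsum_mul_right]
  refine ENNReal.tsum_le_tsum fun n => ?_
  have h2 : ∑' x, ‖((n.factorial : ℂ)⁻¹ * z ^ n) * (H ^ n) f x * (v x : ℂ)‖ₑ
      = ‖(n.factorial : ℂ)⁻¹ * z ^ n‖ₑ * weightedNorm v ((H ^ n) f) :=
    weightedNorm_smul v _ _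
  have h3 : ‖(n.factorial : ℂ)⁻¹ * z ^ n‖ₑ = ENNReal.ofReal ((n.factorial : ℝ)⁻¹ * ‖z‖ ^ n) := by
    rw [← ofReal_norm, norm_mul, norm_inv, norm_pow, Complex.norm_natCast]
  rw [h2, h3, mul_pow, mul_left_comm, mul_comm (K ^ n),
    ENNReal.ofReal_mul (p := _ * _) (by positivity), mul_assoc (ENNReal.ofReal _), ENNReal.ofReal_pow hK]
  gcongr
  exact weightedNorm_pow_le hN f n

theorem weightedNorm_expOp_le (hK : 0 ≤ K)
    (hN : ∀ f : L2 V, weightedNorm v (H f) ≤ ENNReal.ofReal K * weightedNorm v f)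
    (z : ℂ) (f : L2 V) :
    weightedNorm v (expOp z H f) ≤ ENNReal.ofReal (Real.exp (K * ‖z‖)) * weightedNorm v f := by
  refine le_trans ?_ (tsum_weightedNorm_expSeries_le hK hN z f)
  rw [ENNReal.tsum_comm]
  refine ENNReal.tsum_le_tsum fun x => ?_
  rw [← ((hasSum_expOp_apply_apply z H f x).mul_right (v x : ℂ)).tsum_eq]
  exact enorm_tsum_le_tsum_enorm

theorem tsum_expOp_mul (hK : 0 ≤ K)
    (hN : ∀ f : L2 V, weightedNorm v (H f) ≤ ENNReal.ofReal K * weightedNorm v f)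
    (h0 : ∀ f : L2 V, weightedNorm v f ≠ ∞ → ∑' x, H f x * (v x : ℂ) = 0)
    (z : ℂ) {f : L2 V} (hf : weightedNorm v f ≠ ∞) :
    ∑' x, expOp z H f x * (v x : ℂ) = ∑' x, f x * (v x : ℂ) := by
  have hs : Summable (Function.uncurry fun (n : ℕ) (x : V) =>
      ((n.factorial : ℂ)⁻¹ * z ^ n) * (H ^ n) f x * (v x : ℂ)) := by
    refine (tsum_enorm_ne_top_iff_summable_norm.1 ?_).of_norm
    rw [ENNReal.tsum_prod']
    exact ne_top_of_le_ne_top (ENNReal.mul_ne_top ENNReal.ofReal_ne_top hf)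
      (tsum_weightedNorm_expSeries_le hK hN z f)
  calc ∑' x, expOp z H f x * (v x : ℂ)
      = ∑' x, ∑' n : ℕ, ((n.factorial : ℂ)⁻¹ * z ^ n) * (H ^ n) f x * (v x : ℂ) := by
        congr 1
        ext1 x
        exact ((hasSum_expOp_apply_apply z H f x).mul_right (v x : ℂ)).tsum_eq.symm
    _ = ∑' n : ℕ, ∑' x, ((n.factorial : ℂ)⁻¹ * z ^ n) * (H ^ n) f x * (v x : ℂ) :=
        hs.tsum_comm
    _ = ∑' x, f x * (v x : ℂ) := by
        rw [tsum_eq_single 0]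
        · simp
        · intro n hn
          -- Every term with `n ≥ 1` has the form `H (H^k f)`, where `H^k f` has finite weighted
          -- norm, so `h0` annihilates it.
          obtain ⟨k, rfl⟩ := Nat.exists_eq_succ_of_ne_zero hn
          simp only [mul_assoc]
          rw [tsum_mul_left, tsum_mul_left, Nat.succ_eq_add_one, pow_succ' H]
          have := h0 ((H ^ k) f) (ne_top_of_le_ne_top
            (ENNReal.mul_ne_top (ENNReal.pow_ne_top ENNReal.ofReal_ne_top) hf)
            (weightedNorm_pow_le hN f k))
          rw [mul_apply_eq_comp, this, mul_zero, mul_zero]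

theorem weightedNorm_gaussianAverage_ne_top [Countable V] (hK : 0 ≤ K)
    (hN : ∀ f : L2 V, weightedNorm v (H f) ≤ ENNReal.ofReal K * weightedNorm v f)
    (p : Polynomial ℂ) (a b : ℝ) (hb : 0 < b) (x : V) :
    weightedNorm v (gaussianAverage H p a b x) ≠ ∞ := by
  refine ne_top_of_le_ne_top ?_ (weightedNorm_integral_le v
    (integrable_polynomial_gaussian_smul_expOp H p a b hb (delta x)))
  have h1 : ∫⁻ t : ℝ, ‖‖p.eval (t : ℂ) * (Real.exp (-(t - a) ^ 2 / b) : ℂ)‖ *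
      Real.exp (K * |t|)‖ₑ * ‖(v x : ℂ)‖ₑ ≠ ∞ := by
    rw [MeasureTheory.lintegral_mul_const' _ _ enorm_ne_top]
    exact ENNReal.mul_ne_top (integrable_polynomial_gaussian p a b K hb).2.ne enorm_ne_top
  refine ne_top_of_le_ne_top h1 (MeasureTheory.lintegral_mono fun t => ?_)
  rw [lp.coeFn_smul, weightedNorm_smul, enorm_mul ‖_‖, enorm_norm, mul_assoc,
    Real.enorm_of_nonneg (Real.exp_nonneg _)]
  gcongr
  have h2 := weightedNorm_expOp_le hK hN (Complex.I * t) (delta x)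
  rwa [weightedNorm_delta, norm_mul, Complex.norm_I, one_mul, Complex.norm_real,
    Real.norm_eq_abs] at h2

theorem weightedNorm_ne_top_of_mem_frakH2 [Countable V] (hK : 0 ≤ K)
    (hN : ∀ f : L2 V, weightedNorm v (H f) ≤ ENNReal.ofReal K * weightedNorm v f)
    {u : L2 V} (hu : u ∈ frakH2 H) : weightedNorm v u ≠ ∞ := by
  induction hu using Submodule.span_induction with
  | mem u hu =>
    obtain ⟨p, a, b, x, hb, rfl⟩ := hu
    exact weightedNorm_gaussianAverage_ne_top hK hN p a b hb x
  | zero => simp [weightedNorm]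
  | add f g _ _ hf hg =>
    rw [lp.coeFn_add]
    exact ne_top_of_le_ne_top (ENNReal.add_ne_top.2 ⟨hf, hg⟩) (weightedNorm_add_le v f g)
  | smul c f _ hf =>
    rw [lp.coeFn_smul, weightedNorm_smul]
    exact ENNReal.mul_ne_top enorm_ne_top hf

end Exponential

section Matrix

variable {m : V → V → ℕ} {d : ℕ} {v : V → ℝ} {κ : ℝ}

/-- By symmetry the `v`-weighted column sums equal the row sums `κ v y`; nonnegativity of `m` and
`v` makes this an equality rather than a bound. -/
theorem tsum_enorm_matrix_mul (hs : ∀ x y, m x y = m y x) (hv0 : ∀ x, 0 < v x)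
    (hv : ∀ x, HasSum (fun y => (m x y : ℝ) * v y) (κ * v x)) (f : V → ℂ) :
    ∑' y, ∑' x, ‖(m x y : ℂ) * f y * (v x : ℂ)‖ₑ = ENNReal.ofReal κ * weightedNorm v f := by
  have h1 : ∀ y, ∑' x, ‖(m x y : ℂ) * (v x : ℂ)‖ₑ = ENNReal.ofReal κ * ‖(v y : ℂ)‖ₑ := by
    intro y
    have h2 : ∀ x, 0 ≤ (m y x : ℝ) * v x := fun x => mul_nonneg (by positivity) (hv0 x).le
    calc ∑' x, ‖(m x y : ℂ) * (v x : ℂ)‖ₑ = ∑' x, ENNReal.ofReal ((m y x : ℝ) * v x) := by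
          congr 1
          ext1 x
          rw [hs x y, ← enorm_ofReal_of_nonneg (h2 x)]
          push_cast
          rfl
      _ = ENNReal.ofReal (κ * v y) := by
          rw [← ENNReal.ofReal_tsum_of_nonneg h2 (hv y).summable, (hv y).tsum_eq]
      _ = _ := by
          rw [ENNReal.ofReal_mul' (hv0 y).le, enorm_ofReal_of_nonneg (hv0 y).le]
  rw [weightedNorm, ← ENNReal.tsum_mul_left]
  congr 1
  ext1 y
  rw [enorm_mul, mul_left_comm, ← h1, ← ENNReal.tsum_mul_left]
  congr 1
  ext1 x
  rw [← enorm_mul]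
  congr 1
  ring

theorem weightedNorm_matrixOperator_le (hs : ∀ x y, m x y = m y x)
    (hd : ∀ x, ∀ s : Finset V, ∑ y ∈ s, m x y ≤ d) (hv0 : ∀ x, 0 < v x)
    (hv : ∀ x, HasSum (fun y => (m x y : ℝ) * v y) (κ * v x)) (f : L2 V) :
    weightedNorm v (matrixOperator hs hd f) ≤ ENNReal.ofReal κ * weightedNorm v f := by
  rw [← tsum_enorm_matrix_mul hs hv0 hv, ENNReal.tsum_comm]
  refine ENNReal.tsum_le_tsum fun x => ?_
  rw [matrixOperator_apply, ← tsum_mul_right]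
  exact enorm_tsum_le_tsum_enorm

theorem tsum_matrixOperator_mul (hs : ∀ x y, m x y = m y x)
    (hd : ∀ x, ∀ s : Finset V, ∑ y ∈ s, m x y ≤ d) (hv0 : ∀ x, 0 < v x)
    (hv : ∀ x, HasSum (fun y => (m x y : ℝ) * v y) (κ * v x)) {f : L2 V}
    (hf : weightedNorm v f ≠ ∞) :
    ∑' x, matrixOperator hs hd f x * (v x : ℂ) = κ * ∑' x, f x * (v x : ℂ) := by
  have hsum : Summable (Function.uncurry fun (y x : V) => (m x y : ℂ) * f y * (v x : ℂ)) := by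
    refine (tsum_enorm_ne_top_iff_summable_norm.1 ?_).of_norm
    rw [ENNReal.tsum_prod']
    exact ne_top_of_le_ne_top (ENNReal.mul_ne_top ENNReal.ofReal_ne_top hf)
      (tsum_enorm_matrix_mul hs hv0 hv f).le
  calc ∑' x, matrixOperator hs hd f x * (v x : ℂ)
      = ∑' x, ∑' y, (m x y : ℂ) * f y * (v x : ℂ) := by
        congr 1
        ext1 x
        rw [matrixOperator_apply, ← tsum_mul_right]
    _ = ∑' y, ∑' x, (m x y : ℂ) * f y * (v x : ℂ) := hsum.tsum_comm
    _ = ∑' y, κ * (f y * (v y : ℂ)) := by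
        congr 1
        ext1 y
        have h := (Complex.hasSum_ofReal.2 (hv y)).mul_left (f y)
        rw [show (κ : ℂ) * (f y * v y) = f y * ((κ * v y : ℝ) : ℂ) by push_cast; ring, ← h.tsum_eq]
        congr 1
        ext1 x
        rw [hs x y]
        push_cast
        ring
    _ = _ := tsum_mul_left

end Matrix

/-! ### Transfer from the adjacency operator to the Hamiltonian. -/

section Hamiltonian

variable {v : V → ℝ} {A : L2 V →L[ℂ] L2 V}

theorem hamiltonian_apply_apply (A : L2 V →L[ℂ] L2 V) (f : L2 V) (x : V) :
    hamiltonian A f x = ‖A‖ * f x - A f x := rfl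

theorem weightedNorm_hamiltonian_le
    (hN : ∀ f : L2 V, weightedNorm v (A f) ≤ ENNReal.ofReal ‖A‖ * weightedNorm v f) (f : L2 V) :
    weightedNorm v (hamiltonian A f) ≤ ENNReal.ofReal (‖A‖ + ‖A‖) * weightedNorm v f := by
  have h : ⇑(hamiltonian A f) = (‖A‖ : ℂ) • ⇑f + (-1 : ℂ) • ⇑(A f) := by
    ext x
    simp [hamiltonian_apply_apply, sub_eq_add_neg]
  rw [h, ENNReal.ofReal_add (norm_nonneg A) (norm_nonneg A), add_mul]
  refine (weightedNorm_add_le _ _ _).trans (add_le_add ?_ ?_)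
  · rw [weightedNorm_smul, enorm_ofReal_of_nonneg (norm_nonneg A)]
  · rw [weightedNorm_smul, enorm_neg, enorm_one, one_mul]
    exact hN f

/-- This replaces self-adjointness against `H v = 0`, which is only formal because `v` need not lie
in `ℓ²`. -/
theorem tsum_hamiltonian_mul
    (hN : ∀ f : L2 V, weightedNorm v (A f) ≤ ENNReal.ofReal ‖A‖ * weightedNorm v f)
    (hA : ∀ f : L2 V, weightedNorm v f ≠ ∞ →
      ∑' x, A f x * (v x : ℂ) = ‖A‖ * ∑' x, f x * (v x : ℂ))
    (f : L2 V) (hf : weightedNorm v f ≠ ∞) : ∑' x, hamiltonian A f x * (v x : ℂ) = 0 := by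
  have hAf : weightedNorm v (A f) ≠ ∞ :=
    ne_top_of_le_ne_top (ENNReal.mul_ne_top ENNReal.ofReal_ne_top hf) (hN f)
  simp only [hamiltonian_apply_apply, sub_mul, mul_assoc]
  rw [((summable_of_weightedNorm_ne_top hf).mul_left _).tsum_sub
    (summable_of_weightedNorm_ne_top hAf), tsum_mul_left, hA f hf, sub_self]

end Hamiltonian

theorem pairing_eq_conj_tsum (u : L2 V) (v : V → ℝ) :
    pairing u v = (starRingEnd ℂ) (∑' x, u x * (v x : ℂ)) := by
  rw [pairing, Complex.conj_tsum]
  simp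

end Weighted

theorem IsPerronFrobeniusWeight.hasSum_edgeCount {α β : Type*} {G : Graph α β}
    {hG : HasBoundedDegree G} {v : V(G) → ℝ}
    (hv : IsPerronFrobeniusWeight (adjacencyOperator G hG) v) (x : V(G)) :
    HasSum (fun y => (edgeCount G x y : ℝ) * v y) (‖adjacencyOperator G hG‖ * v x) := by
  have h := hv.2 x
  simp only [inner_delta_adjacencyOperator] at h
  rw [← Complex.hasSum_ofReal]
  simpa using h

end GraphBEC

end

theorem mainTheorem11 {α β : Type*} (G : Graph α β) [Countable V(G)]
    (hconn : GraphBEC.IsConnected G) (hdeg : GraphBEC.HasBoundedDegree G)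
    (A H : GraphBEC.L2 V(G) →L[ℂ] GraphBEC.L2 V(G))
    (hA : A = GraphBEC.adjacencyOperator G hdeg) (hH : H = GraphBEC.hamiltonian A)
    (htrans : GraphBEC.IsTransient A) :
    (∀ t : ℝ, (GraphBEC.frakH2 H).map (GraphBEC.expOp (Complex.I * t) H).toLinearMap
        = GraphBEC.frakH2 H) ∧
    ∀ b : ℝ, 0 < b →
      (∀ u ∈ GraphBEC.frakH2 H, GraphBEC.expOp b H u
          ∈ (GraphBEC.invSqrt (GraphBEC.expOp b H - 1)).domain) ∧
      (∀ v : V(G) → ℝ, GraphBEC.IsPerronFrobeniusWeight A v → ∀ u ∈ GraphBEC.frakH2 H,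
        (Summable fun x => ‖GraphBEC.expOp b H u x‖ * v x) ∧
        (Summable fun x => ‖u x‖ * v x) ∧
        GraphBEC.pairing (GraphBEC.expOp b H u) v = GraphBEC.pairing u v) := by
  have hsa : IsSelfAdjoint A := hA ▸ GraphBEC.isSelfAdjoint_adjacencyOperator hdeg
  subst hH
  refine ⟨GraphBEC.map_frakH2 _, fun b hb =>
    ⟨fun u hu => GraphBEC.expOp_mem_invSqrt_domain hsa htrans hb hu, fun v hv u hu => ?_⟩⟩
  have hN : ∀ f : GraphBEC.L2 V(G),
      GraphBEC.weightedNorm v (A f) ≤ ENNReal.ofReal ‖A‖ * GraphBEC.weightedNorm v f := by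
    subst hA
    exact GraphBEC.weightedNorm_matrixOperator_le _ _ hv.1 hv.hasSum_edgeCount
  have hS : ∀ f : GraphBEC.L2 V(G), GraphBEC.weightedNorm v f ≠ ⊤ →
      ∑' x, A f x * (v x : ℂ) = ‖A‖ * ∑' x, f x * (v x : ℂ) := by
    subst hA
    exact fun f hf => GraphBEC.tsum_matrixOperator_mul _ _ hv.1 hv.hasSum_edgeCount hf
  have hK : 0 ≤ ‖A‖ + ‖A‖ := by positivity
  have hNH := GraphBEC.weightedNorm_hamiltonian_le hN
  have hfin := GraphBEC.weightedNorm_ne_top_of_mem_frakH2 hK hNH hu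
  refine ⟨GraphBEC.summable_norm_mul_of_weightedNorm_ne_top hv.1
    (ne_top_of_le_ne_top (ENNReal.mul_ne_top ENNReal.ofReal_ne_top hfin)
      (GraphBEC.weightedNorm_expOp_le hK hNH b u)),
    GraphBEC.summable_norm_mul_of_weightedNorm_ne_top hv.1 hfin, ?_⟩
  rw [GraphBEC.pairing_eq_conj_tsum, GraphBEC.pairing_eq_conj_tsum,
    GraphBEC.tsum_expOp_mul hK hNH (GraphBEC.tsum_hamiltonian_mul hN hS) b hfin]
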